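/- Let $p$ be a prime and let $F$ be a field which contains a primitive $p$-th root of unity if $p$ is odd, and a primitive fourth root of unity if $p=2$. Let $G_F(p)$ be the maximal pro-$p$ quotient of the absolute Galois group $\mathrm{Gal}(F_{sep}/F)$. Let $$1\longrightarrow R\longrightarrow S\stackrel{\pi}{\longrightarrow} G_F(p)\longrightarrow 1$$ be a minimal presentation of $G_F(p)$, where $S$ is a free pro-$p$ group on a set of generators $\{x\}\sqcup\{y_i\mid i\in I\}$ converging to $1$ (that is, every neighbourhood of $1$ contains all but finitely many of the generators); minimality means that the images under $\pi$ of these generators form a minimal system of topological generators of $G_F(p)$ (no generator can be omitted). Let $T$ be the closed subgroup of $S$ generated by $\{y_i\}_{i\in I}$. Then there is no relation in $R$ of the form $x^{p^l u}s$, where $l$ and $u$ are nonzero integers with $l\ge 1$ and $\gcd(p,u)=1$, and $s\in T$. -/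

import Mathlib

open Filter Topology

universe v w

/-- The topological group `G` is a pro-`p` group: it is profinite (compact and totally disconnected)
and all its open normal subgroups have index a power of `p`. -/
structure IsProP (p : ℕ) (G : Type*) [Group G] [TopologicalSpace G] [IsTopologicalGroup G] :
    Prop where
  compact : CompactSpace G
  totallyDisconnected : TotallyDisconnectedSpace G
  index_eq_pow : ∀ U : Subgroup G, U.Normal → IsOpen (U : Set G) → ∃ n : ℕ, U.index = p ^ n

/-- The topological group `S` is the free pro-`p` group on the family `ι : X → S`, in the usual sense
of families converging to `1` (every neighbourhood of `1` contains all but finitely many members; no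
condition if `X` is finite): `S` is pro-`p`, the family `ι` converges to `1`, and every family
`f : X → P` converging to `1` in a pro-`p` group `P` extends uniquely to a continuous homomorphism
`S → P`. (As a pro-`p` group is determined by its finite quotients, and finite groups live in every
universe, it makes no difference that `P` ranges over the universe of `S`.) -/
structure IsFreeProP (p : ℕ) {X : Type v} {S : Type w} [Group S] [TopologicalSpace S]
    [IsTopologicalGroup S] (ι : X → S) : Prop where
  isProP : IsProP p S
  tendsto_one : Tendsto ι cofinite (𝓝 1)
  existsUnique_lift : ∀ (P : Type w) [Group P] [TopologicalSpace P] [IsTopologicalGroup P],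
    IsProP p P → ∀ f : X → P, Tendsto f cofinite (𝓝 1) →
      ∃! φ : S →ₜ* P, ∀ j : X, φ (ι j) = f j

/-- The closed subgroup of `G` (topologically) generated by the subset `A`. -/
def closedSubgroupClosure {G : Type*} [Group G] [TopologicalSpace G] [IsTopologicalGroup G]
    (A : Set G) : Subgroup G :=
  (Subgroup.closure A).topologicalClosure

/-- The family `g : X → G` is a minimal system of (topological) generators of `G`: it converges to
`1`, it generates `G` topologically, and it no longer does so when any of its members is omitted. -/
structure IsMinimalGeneratingSystem {X G : Type*} [Group G] [TopologicalSpace G]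
    [IsTopologicalGroup G] (g : X → G) : Prop where
  tendsto_one : Tendsto g cofinite (𝓝 1)
  generates : closedSubgroupClosure (Set.range g) = ⊤
  minimal : ∀ j : X, closedSubgroupClosure (g '' {j}ᶜ) ≠ ⊤

/-- The intersection of all open normal subgroups of `p`-power index, that is, the kernel of the
projection of the profinite group `G` onto its maximal pro-`p` quotient. -/
def maxProPKernel (p : ℕ) (G : Type*) [Group G] [TopologicalSpace G] : Subgroup G :=
  sInf {U : Subgroup G | U.Normal ∧ IsOpen (U : Set G) ∧ ∃ n : ℕ, U.index = p ^ n}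

instance maxProPKernel_normal (p : ℕ) (G : Type*) [Group G] [TopologicalSpace G] :
    (maxProPKernel p G).Normal where
  conj_mem a ha g := by
    unfold maxProPKernel at ha ⊢
    rw [Subgroup.mem_sInf] at ha ⊢
    intro U hU
    exact hU.1.conj_mem a (ha U hU) g

/-- The maximal pro-`p` quotient of the profinite group `G`, with the quotient topology. -/
abbrev MaxProPQuotient (p : ℕ) (G : Type*) [Group G] [TopologicalSpace G] : Type _ :=
  G ⧸ maxProPKernel p G

/-- `G_F(p)`: the maximal pro-`p` quotient of the absolute Galois group `Gal(F_sep / F)` (with its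
Krull topology). -/
abbrev GaloisProP (p : ℕ) (F : Type*) [Field F] : Type _ :=
  MaxProPQuotient p (SeparableClosure F ≃ₐ[F] SeparableClosure F)

/-- The family consisting of `x` and of all `y i`. -/
def adjoinFamily {I S : Type*} (x : S) (y : I → S) : Option I → S
  | none => x
  | some i => y i

/-- The continuous homomorphism `π : S → G` is a minimal presentation of `G` on the family
`ι : X → S`: `S` is the free pro-`p` group on `ι`, `π` is surjective, and `π` maps the free generators
to a minimal system of generators of `G`. Its group of relations is `R = ker π`. -/
structure IsMinimalPresentation (p : ℕ) {X : Type v} {S : Type w} {G : Type*} [Group S]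
    [TopologicalSpace S] [IsTopologicalGroup S] [Group G] [TopologicalSpace G]
    [IsTopologicalGroup G] (ι : X → S) (π : S →ₜ* G) : Prop where
  isFree : IsFreeProP p ι
  surjective : Function.Surjective π
  minimal : IsMinimalGeneratingSystem (π ∘ ι)

/-! ### Subgroups of `p`-power index and the maximal pro-`p` quotient. -/

section ProPKernel

variable {Γ : Type*} [Group Γ] {p : ℕ}

/-! Lift the images of the generators to Galois automorphisms `η k`. Minimality and Kummer theory
give dual `p`-th roots (`IsMinimalGeneratingSystem.exists_dual_root`). Extracting further `p`-th
roots, and correcting each by finitely many dual ones, makes them dual `p ^ (n + 1)`-th roots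
(`exists_dual_pow_root`). For `x` and `n = l` this gives `β`, fixed by the lifts of the `y i`, with
`σ β = ζ * β`, where `σ` lifts the image of `x` and `ζ` is primitive of order `p ^ (l + 1)`. A
relation would make `σ ^ (p ^ l * |u|)` fix `β`. If `σ ζ = ζ ^ k`, then `p ^ (l + 1)` divides `1 + k
+ ⋯ + k ^ (p ^ l * |u| - 1)`. The roots of unity in `F` force `k ≡ 1` modulo `p` (modulo `4` if `p =
2`), so lifting the exponent excludes this (`not_pow_succ_dvd_geom_sum`). Over the reals, `k = -1`
and the sum `1 + k` vanishes: hence the fourth root of unity. -/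

theorem exists_index_inf_eq_pow (hp : p.Prime) {U V : Subgroup Γ} (hV : V.Normal)
    (hUi : ∃ n : ℕ, U.index = p ^ n) (hVi : ∃ n : ℕ, V.index = p ^ n) :
    ∃ n : ℕ, (U ⊓ V).index = p ^ n := by
  obtain ⟨a, ha⟩ := hUi
  obtain ⟨b, hb⟩ := hVi
  have h := Subgroup.relIndex_mul_index (inf_le_left : U ⊓ V ≤ U)
  rw [Subgroup.inf_relIndex_left] at h
  obtain ⟨c, -, hc⟩ := (Nat.dvd_prime_pow hp).1
    (hb ▸ Subgroup.relIndex_dvd_index_of_normal V U)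
  exact ⟨c + a, by rw [← h, hc, ha, pow_add]⟩

/-- A proper subgroup of a finite `p`-group lies in a normal subgroup of index `p`. -/
theorem exists_normal_index_eq_prime_of_card_eq_pow {Q : Type*} [Group Q] [Finite Q]
    (hp : p.Prime) {n : ℕ} (hn : Nat.card Q = p ^ n) {H : Subgroup Q} (hH : H ≠ ⊤) :
    ∃ K : Subgroup Q, K.Normal ∧ K.index = p ∧ H ≤ K := by
  have := Fact.mk hp
  obtain ⟨m, hmn, hm⟩ := (Nat.dvd_prime_pow hp).1 (hn ▸ Subgroup.card_subgroup_dvd_card H)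
  have hlt : m < n := by
    refine lt_of_le_of_ne hmn fun h => hH ?_
    apply Subgroup.eq_top_of_card_eq
    rw [hm, hn, h]
  obtain ⟨k, rfl⟩ : ∃ k, n = k + 1 := ⟨n - 1, by omega⟩
  obtain ⟨K, hK, hHK⟩ := Sylow.exists_subgroup_card_pow_prime_le p
    (hn ▸ pow_dvd_pow p (Nat.le_succ k)) H hm (Nat.lt_succ_iff.1 hlt)
  have hi : K.index = p := by
    have := K.card_mul_index
    rw [hK, hn, pow_succ] at this
    exact Nat.eq_of_mul_eq_mul_left (pow_pos hp.pos k) this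
  refine ⟨K, Subgroup.normal_of_index_eq_minFac_card ?_, hi, hHK⟩
  rw [hi, hn, hp.pow_minFac (Nat.succ_ne_zero k)]

theorem mk_mem_map_mk_iff {N U : Subgroup Γ} [N.Normal] (hN : N ≤ U) (σ : Γ) :
    (σ : Γ ⧸ N) ∈ U.map (QuotientGroup.mk' N) ↔ σ ∈ U := by
  constructor
  · rintro ⟨τ, hτ, h⟩
    have : τ⁻¹ * σ ∈ N := QuotientGroup.eq.1 h
    simpa using U.mul_mem hτ (hN this)
  · exact fun h => ⟨σ, h, rfl⟩

variable [TopologicalSpace Γ] [IsTopologicalGroup Γ]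

/-- A proper closed subgroup containing the kernel of the projection onto the maximal pro-`p`
quotient is contained in an open normal subgroup of index `p`. -/
theorem exists_open_normal_index_eq_prime [CompactSpace Γ] (hp : p.Prime) {H : Subgroup Γ}
    (hc : IsClosed (H : Set Γ)) (hN : maxProPKernel p Γ ≤ H) (hH : H ≠ ⊤) :
    ∃ M : Subgroup Γ, M.Normal ∧ IsOpen (M : Set Γ) ∧ M.index = p ∧ H ≤ M := by
  obtain ⟨g, hg⟩ : ∃ g, g ∉ H := by
    by_contra! h
    exact hH (eq_top_iff.2 fun x _ => h x)
  let J := {U : Subgroup Γ // U.Normal ∧ IsOpen (U : Set Γ) ∧ ∃ n : ℕ, U.index = p ^ n}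
  have : Nonempty J := ⟨⟨⊤, inferInstance, isOpen_univ, 0, by simp⟩⟩
  -- Compactness: if every `U` in the directed family met `g⁻¹H`, so would their intersection, the
  -- kernel; as it lies in `H`, this would put `g` in `H`.
  obtain ⟨⟨U, hUn, hUo, n, hUi⟩, hU⟩ := hc.isCompact.elim_directed_family_closed
    (fun U : J => (fun h => g⁻¹ * h) ⁻¹' (U.1 : Set Γ))
    (fun U => (U.1.isClosed_of_isOpen U.2.2.1).preimage (continuous_const_mul g⁻¹))
    (by
      refine Set.eq_empty_iff_forall_notMem.2 fun h ⟨hh, hi⟩ => hg ?_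
      have hm : g⁻¹ * h ∈ maxProPKernel p Γ := by
        refine Subgroup.mem_sInf.2 fun U hU => ?_
        exact Set.mem_iInter.1 hi ⟨U, hU⟩
      have := H.mul_mem hh (H.inv_mem (hN hm))
      simpa [mul_assoc] using this)
    (by
      rintro ⟨U, hUn, hUo, hUi⟩ ⟨V, hVn, hVo, hVi⟩
      refine ⟨⟨U ⊓ V, inferInstance, hUo.inter hVo,
        exists_index_inf_eq_pow hp hVn hUi hVi⟩, ?_, ?_⟩
      · exact fun x hx => hx.1
      · exact fun x hx => hx.2)
  have : Finite (Γ ⧸ U) := U.quotient_finite_of_isOpen hUo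
  have hne : H.map (QuotientGroup.mk' U) ≠ ⊤ := by
    intro h
    obtain ⟨x, hx, hxg⟩ := (h ▸ Subgroup.mem_top (QuotientGroup.mk' U g) :
      QuotientGroup.mk' U g ∈ H.map (QuotientGroup.mk' U))
    have : g⁻¹ * x ∈ U := QuotientGroup.eq.1 hxg.symm
    exact Set.eq_empty_iff_forall_notMem.1 hU x ⟨hx, this⟩
  obtain ⟨K, hKn, hKi, hHK⟩ := exists_normal_index_eq_prime_of_card_eq_pow hp
    (n := n) (by rw [← Subgroup.index_eq_card, hUi]) hne
  refine ⟨K.comap (QuotientGroup.mk' U), inferInstance, ?_, ?_, Subgroup.map_le_iff_le_comap.1 hHK⟩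
  · refine Subgroup.isOpen_mono (H₁ := U) (fun x hx => ?_) hUo
    rw [Subgroup.mem_comap, QuotientGroup.mk'_apply, (QuotientGroup.eq_one_iff x).2 hx]
    exact K.one_mem
  · rw [Subgroup.index_comap_of_surjective _ (QuotientGroup.mk'_surjective U), hKi]

theorem isOpen_map_mk {N U : Subgroup Γ} [N.Normal] (hU : IsOpen (U : Set Γ)) :
    IsOpen (U.map (QuotientGroup.mk' N) : Set (Γ ⧸ N)) :=
  QuotientGroup.isOpenMap_coe _ hU

/-- An open subgroup containing `N` and lifts of the elements of `A` contains every lift of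
every element of the closed subgroup of `Γ ⧸ N` generated by `A`. -/
theorem mem_of_mk_mem_closedSubgroupClosure {N U : Subgroup Γ} [N.Normal] (hN : N ≤ U)
    (hU : IsOpen (U : Set Γ)) {A : Set (Γ ⧸ N)} (hA : ∀ τ : Γ, (τ : Γ ⧸ N) ∈ A → τ ∈ U)
    {σ : Γ} (hσ : (σ : Γ ⧸ N) ∈ closedSubgroupClosure A) : σ ∈ U := by
  rw [← mk_mem_map_mk_iff hN]
  refine Subgroup.topologicalClosure_minimal _ ?_
    (Subgroup.isClosed_of_isOpen _ (isOpen_map_mk hU)) hσ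
  rw [Subgroup.closure_le]
  intro a ha
  obtain ⟨τ, rfl⟩ := QuotientGroup.mk_surjective a
  exact (mk_mem_map_mk_iff hN τ).2 (hA τ ha)

end ProPKernel

/-! ### Valuation of a geometric sum. -/

section GeometricSum

/-- If `k ≡ 1` modulo `p` (modulo `4` if `p = 2`) and `u` is prime to `p`, the `p`-adic valuation
of `1 + k + ⋯ + k ^ (p ^ l * u - 1)` is at most `l`. -/
theorem not_pow_succ_dvd_geom_sum {p : ℕ} (hp : p.Prime) {k : ℤ} (hk : (p : ℤ) ∣ k - 1)
    (hk2 : p = 2 → 4 ∣ k - 1) (l : ℕ) {u : ℕ} (hu : ¬ p ∣ u) :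
    ¬ (p : ℤ) ^ (l + 1) ∣ ∑ i ∈ Finset.range (p ^ l * u), k ^ i := by
  have hm : ¬ p ^ (l + 1) ∣ p ^ l * u := by
    rw [pow_succ]
    exact fun h => hu (Nat.dvd_of_mul_dvd_mul_left (pow_pos hp.pos l) h)
  -- `k = 1` is separate: the valuation of `k - 1` must be finite to be cancelled below.
  rcases eq_or_ne k 1 with rfl | hk1
  · simpa using mod_cast hm
  have hpk : ¬ (p : ℤ) ∣ k := fun h => by
    have := dvd_sub h hk
    rw [sub_sub_cancel] at this
    exact hp.one_lt.ne' (by exact_mod_cast Int.eq_one_of_dvd_one (by positivity) this)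
  have hpZ : Prime (p : ℤ) := Nat.prime_iff_prime_int.1 hp
  have key : emultiplicity (p : ℤ) (k ^ (p ^ l * u) - 1 ^ (p ^ l * u)) =
      emultiplicity (p : ℤ) (k - 1) + emultiplicity (p : ℤ) ((p ^ l * u : ℕ) : ℤ) := by
    rcases hp.eq_two_or_odd' with rfl | hodd
    · exact Int.two_pow_sub_pow' _ (hk2 rfl) hpk
    · rw [Int.emultiplicity_pow_sub_pow hp hodd hk hpk, Int.natCast_emultiplicity]
  rw [one_pow, ← mul_geom_sum, emultiplicity_mul hpZ] at key
  have hfin : FiniteMultiplicity (p : ℤ) (k - 1) :=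
    Int.finiteMultiplicity_iff.2 ⟨by simpa using hp.one_lt.ne', sub_ne_zero.2 hk1⟩
  have h := ENat.add_right_injective_of_ne_top (finiteMultiplicity_iff_emultiplicity_ne_top.1 hfin) key
  rw [pow_dvd_iff_le_emultiplicity, h, ← pow_dvd_iff_le_emultiplicity]
  exact_mod_cast hm

end GeometricSum

/-! ### Kummer theory and the cyclotomic action. -/

section Kummer

variable {F E : Type*} [Field F] [Field E] [Algebra F E]

theorem isOpen_stabilizer [Algebra.IsAlgebraic F E] (β : E) :
    IsOpen (MulAction.stabilizer Gal(E/F) β : Set Gal(E/F)) := by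
  have := IntermediateField.adjoin.finiteDimensional (Algebra.IsIntegral.isIntegral (R := F) β)
  refine Subgroup.isOpen_mono (fun σ hσ => ?_)
    (IntermediateField.fixingSubgroup_isOpen (IntermediateField.adjoin F {β}))
  exact (IntermediateField.mem_fixingSubgroup_iff _ σ).1 hσ β
    (IntermediateField.mem_adjoin_simple_self F β)

/-- An open normal subgroup of prime index `p` of a Galois group is the stabilizer of a `p`-th root
of an element of the base field, if the latter contains a primitive `p`-th root of unity. -/
theorem exists_pow_mem_forall_mem_iff [IsGalois F E] {p : ℕ} (hp : p.Prime) {z : F}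
    (hz : IsPrimitiveRoot z p) {M : Subgroup Gal(E/F)} (hn : M.Normal)
    (ho : IsOpen (M : Set Gal(E/F))) (hi : M.index = p) :
    ∃ α : E, α ^ p ∈ Set.range (algebraMap F E) ∧ ∀ σ : Gal(E/F), σ ∈ M ↔ σ α = α := by
  let H : ClosedSubgroup Gal(E/F) := ⟨M, M.isClosed_of_isOpen ho⟩
  have : H.Normal := hn
  let L := IntermediateField.fixedField M
  have hfix : L.fixingSubgroup = M := InfiniteGalois.fixingSubgroup_fixedField H
  obtain ⟨h1, h2⟩ := (InfiniteGalois.isOpen_and_normal_iff_finite_and_isGalois L).1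
    (by rw [hfix]; exact ⟨ho, hn⟩)
  have hcard : Nat.card Gal(L/F) = p := by
    rw [← hi, Subgroup.index_eq_card]
    exact (Nat.card_congr (InfiniteGalois.normalAutEquivQuotient H).toEquiv).symm
  have hrank : Module.finrank F L = p := by rw [← IsGalois.card_aut_eq_finrank, hcard]
  have := Fact.mk hp
  have : IsCyclic Gal(L/F) := isCyclic_of_prime_card hcard
  obtain ⟨α, ⟨a, ha⟩, htop⟩ := exists_root_adjoin_eq_top_of_isCyclic F L
    ⟨z, by rw [hrank, mem_primitiveRoots hp.pos]; exact hz⟩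
  refine ⟨α, ⟨a, ?_⟩, fun σ => ⟨fun hσ => ?_, fun hσ => ?_⟩⟩
  · rw [hrank] at ha
    simpa using congrArg (algebraMap L E) ha
  · rw [← hfix] at hσ
    exact (IntermediateField.mem_fixingSubgroup_iff _ σ).1 hσ α α.2
  · rw [← hfix]
    have hL : L = IntermediateField.adjoin F {(α : E)} := by
      have := congrArg (IntermediateField.lift) htop
      rw [IntermediateField.lift_top, IntermediateField.lift_adjoin_simple] at this
      exact this.symm
    have hle : IntermediateField.adjoin F {(α : E)} ≤
        IntermediateField.fixedField (Subgroup.zpowers σ) := by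
      rw [IntermediateField.adjoin_simple_le_iff, IntermediateField.mem_fixedField_iff]
      intro τ hτ
      have : Subgroup.zpowers σ ≤ MulAction.stabilizer Gal(E/F) (α : E) := by
        rw [Subgroup.zpowers_le]; exact hσ
      exact this hτ
    refine (IntermediateField.mem_fixingSubgroup_iff _ σ).2 fun x hx => ?_
    exact (IntermediateField.mem_fixedField_iff _ x).1 (hle (hL ▸ hx)) σ
      (Subgroup.mem_zpowers σ)

/-- An automorphism over a field containing a primitive `d`-th root of unity raises roots of unity
of order a multiple of `d` to powers with exponents congruent to `1` modulo `d`. -/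
theorem exists_apply_eq_pow {d m : ℕ} {z : F} (hz : IsPrimitiveRoot z d) (hdm : d ∣ m) (hm : m ≠ 0)
    {ζ : E} (hζ : IsPrimitiveRoot ζ m) (σ : Gal(E/F)) :
    ∃ k : ℕ, σ ζ = ζ ^ k ∧ (d : ℤ) ∣ k - 1 := by
  have : NeZero m := ⟨hm⟩
  obtain ⟨k, -, hk⟩ := hζ.eq_pow_of_pow_eq_one (ξ := σ ζ) (by rw [← map_pow, hζ.pow_eq_one, map_one])
  refine ⟨k, hk.symm, ?_⟩
  obtain ⟨e, rfl⟩ := hdm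
  have he : IsPrimitiveRoot (ζ ^ e) d := hζ.pow (Nat.pos_of_ne_zero hm) (mul_comm d e)
  have : NeZero d := ⟨left_ne_zero_of_mul hm⟩
  obtain ⟨i, -, hi⟩ := (hz.map_of_injective (algebraMap F E).injective).eq_pow_of_pow_eq_one
    he.pow_eq_one
  -- `ζ ^ e` has order `d`, so it is a power of `z` and lies in the base field.
  have hσ : σ (ζ ^ e) = ζ ^ e := by rw [← hi, map_pow, AlgEquiv.commutes]
  rw [map_pow, ← hk, pow_right_comm] at hσ
  have h := (he.isOfFinOrder (NeZero.ne d)).pow_eq_pow_iff_modEq.1 (hσ.trans (pow_one _).symm)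
  rw [← he.eq_orderOf] at h
  exact (Nat.modEq_iff_dvd.1 h.symm)

/-- Each further `σ` raises the accumulated root of unity to the power `k` and contributes one more
`ζ`; this is the source of the geometric sum. -/
theorem pow_apply_eq_mul {ζ β : E} {σ : Gal(E/F)} {k : ℕ} (hζ : σ ζ = ζ ^ k) (hβ : σ β = ζ * β)
    (j : ℕ) : (σ ^ j) β = ζ ^ (∑ i ∈ Finset.range j, k ^ i) * β := by
  induction j with
  | zero => simp
  | succ j ih =>
    rw [pow_succ', AlgEquiv.mul_apply, ih, map_mul, map_pow, hζ, hβ, geom_sum_succ, pow_succ,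
      pow_mul, mul_assoc]

theorem pow_apply_eq_pow {ζ : E} {σ : Gal(E/F)} {k : ℕ} (hζ : σ ζ = ζ ^ k) (j : ℕ) :
    (σ ^ j) ζ = ζ ^ (k ^ j) := by
  induction j with
  | zero => simp
  | succ j ih => rw [pow_succ', AlgEquiv.mul_apply, ih, map_pow, hζ, ← pow_mul, ← pow_succ']

/-- A `p`-power root of an element of `F` lies in the maximal pro-`p` extension of `F`. -/
theorem maxProPKernel_le_stabilizer [IsGalois F E] {p : ℕ} (hp : p.Prime) {z : F}
    (hz : IsPrimitiveRoot z p) {n : ℕ} {ζ β : E} (hζ : IsPrimitiveRoot ζ (p ^ (n + 1)))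
    (hβ : β ^ p ^ (n + 1) ∈ Set.range (algebraMap F E)) :
    maxProPKernel p Gal(E/F) ≤ MulAction.stabilizer Gal(E/F) β := by
  have := Fact.mk hp
  rcases eq_or_ne β 0 with rfl | hβ0
  · intro σ _
    exact map_zero σ
  obtain ⟨b, hb⟩ := hβ
  have hpn : p ^ (n + 1) ≠ 0 := pow_ne_zero _ hp.ne_zero
  have : NeZero (p ^ (n + 1)) := ⟨hpn⟩
  have hmul : ∀ σ : Gal(E/F), ∃ e : ℕ, σ β = ζ ^ e * β := fun σ => by
    obtain ⟨e, -, he⟩ := hζ.eq_pow_of_pow_eq_one (ξ := σ β / β) (by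
      rw [div_pow, ← map_pow, ← hb, AlgEquiv.commutes, hb, div_self (pow_ne_zero _ hβ0)])
    exact ⟨e, by rw [he, div_mul_cancel₀ _ hβ0]⟩
  have hcyc : ∀ σ : Gal(E/F), ∃ k : ℕ, σ ζ = ζ ^ k ∧ (p : ℤ) ∣ k - 1 :=
    exists_apply_eq_pow hz (dvd_pow_self p n.succ_ne_zero) hpn hζ
  let U : Subgroup Gal(E/F) :=
    MulAction.stabilizer Gal(E/F) ζ ⊓ MulAction.stabilizer Gal(E/F) β
  have memU : ∀ σ : Gal(E/F), σ ∈ U ↔ σ ζ = ζ ∧ σ β = β := fun σ => Iff.rfl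
  have hUo : IsOpen (U : Set Gal(E/F)) := (isOpen_stabilizer ζ).inter (isOpen_stabilizer β)
  -- Stabilizing `ζ` as well makes `U` normal, since every conjugate of `β` is some `ζ ^ e * β`.
  have hUn : U.Normal := by
    refine ⟨fun τ hτ σ => ?_⟩
    obtain ⟨h1, h2⟩ := (memU τ).1 hτ
    obtain ⟨k, hk, -⟩ := hcyc σ⁻¹
    obtain ⟨e, he⟩ := hmul σ⁻¹
    have hinv : ∀ x, σ (σ⁻¹ x) = x := fun x => by
      rw [← AlgEquiv.mul_apply, mul_inv_cancel, AlgEquiv.one_apply]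
    refine (memU _).2 ⟨?_, ?_⟩
    · rw [AlgEquiv.mul_apply, AlgEquiv.mul_apply, hk, map_pow τ, h1, ← hk, hinv]
    · rw [AlgEquiv.mul_apply, AlgEquiv.mul_apply, he, map_mul τ, map_pow τ, h1, h2, ← he, hinv]
  have : Finite (Gal(E/F) ⧸ U) := U.quotient_finite_of_isOpen hUo
  have hpg : IsPGroup p (Gal(E/F) ⧸ U) := by
    intro q
    obtain ⟨σ, rfl⟩ := QuotientGroup.mk_surjective q
    -- The first `p ^ (n + 1)`-th power fixes `ζ`, because `k ^ p ^ (n + 1) ≡ 1` modulo `p ^ (n +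
    -- 1)`; the second then fixes `β` too.
    refine ⟨(n + 1) + (n + 1), ?_⟩
    rw [← QuotientGroup.mk_pow, QuotientGroup.eq_one_iff, pow_add, pow_mul]
    obtain ⟨k, hk, hk1⟩ := hcyc σ
    have h1 : (σ ^ p ^ (n + 1)) ζ = ζ := by
      rw [pow_apply_eq_pow hk]
      conv_rhs => rw [← pow_one ζ]
      rw [(hζ.isOfFinOrder hpn).pow_eq_pow_iff_modEq, ← hζ.eq_orderOf]
      refine (Nat.modEq_iff_dvd.2 ?_).symm
      have := dvd_sub_pow_of_dvd_sub (R := ℤ) hk1 (n + 1)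
      rw [one_pow] at this
      push_cast
      exact (pow_dvd_pow _ (Nat.le_succ _)).trans this
    obtain ⟨e, he⟩ := hmul (σ ^ p ^ (n + 1))
    have h1e : (σ ^ p ^ (n + 1)) (ζ ^ e) = (ζ ^ e) ^ 1 := by rw [map_pow, h1, pow_one]
    refine (memU _).2 ⟨?_, ?_⟩
    · rw [pow_apply_eq_pow (k := 1) (by rw [h1, pow_one]), one_pow, pow_one]
    · rw [pow_apply_eq_mul h1e he]
      simp [← pow_mul, mul_comm e, pow_mul ζ, hζ.pow_eq_one]
  obtain ⟨m, hm⟩ := IsPGroup.iff_card.1 hpg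
  have hle : maxProPKernel p Gal(E/F) ≤ U :=
    sInf_le ⟨hUn, hUo, m, by rw [Subgroup.index_eq_card, hm]⟩
  exact hle.trans inf_le_right

end Kummer

/-! ### Climbing from dual `p`-th roots to dual `p`-power roots. -/

section RootTower

variable {F E X : Type*} [Field F] [Field E] [Algebra F E] {p : ℕ} {η : X → Gal(E/F)}

/-- Given `p`-th roots dual to the family `η`, a Kummer generator `γ` on which all `η k`, `k ≠ j`,
act through `p`-th roots of unity can be modified so that it becomes fixed by all these `η k`. -/
theorem exists_fixed_of_finite (hp : p.Prime)
    (hdual : ∀ j, ∃ α : E, α ^ p ∈ Set.range (algebraMap F E) ∧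
      (∀ k, k ≠ j → η k α = α) ∧ η j α ≠ α) (j : X) (n : ℕ) (s : Finset X) :
    ∀ γ : E, γ ≠ 0 → γ ^ p ^ (n + 1) ∈ Set.range (algebraMap F E) →
      (∀ k, k ≠ j → (η k γ / γ) ^ p = 1) → (∀ k, k ≠ j → k ∉ s → η k γ = γ) →
      ∃ δ : E, δ ≠ 0 ∧ δ ^ p ^ (n + 1) ∈ Set.range (algebraMap F E) ∧
        (∀ k, k ≠ j → η k δ = δ) ∧ η j δ / δ = η j γ / γ := by
  classical
  have := Fact.mk hp
  have : NeZero p := ⟨hp.ne_zero⟩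
  induction s using Finset.induction with
  | empty => exact fun γ h0 hγ _ h => ⟨γ, h0, hγ, fun k hk => h k hk (Finset.notMem_empty k), rfl⟩
  | insert i s his ih =>
    intro γ h0 hγ h1 h2
    by_cases hij : i = j
    · subst hij
      exact ih γ h0 hγ h1 fun k hk hks => h2 k hk (by simp [hk, hks])
    obtain ⟨α, ⟨a, ha⟩, hfix, hne⟩ := hdual i
    have hα0 : α ≠ 0 := by
      rintro rfl
      exact hne (map_zero _)
    have hω : IsPrimitiveRoot (η i α / α) p := by
      rw [IsPrimitiveRoot.iff_orderOf]
      refine orderOf_eq_prime ?_ fun h => hne ((div_eq_one_iff_eq hα0).1 h)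
      rw [div_pow, ← map_pow, ← ha, AlgEquiv.commutes, ha, div_self (pow_ne_zero _ hα0)]
    -- The factor `α ^ f` cancels the action of `η i` on `γ`; by duality it does not change the
    -- action of the other `η k`, including `η j`.
    obtain ⟨f, -, hf⟩ := hω.eq_pow_of_pow_eq_one (ξ := (η i γ / γ)⁻¹)
      (by rw [inv_pow, h1 i hij, inv_one])
    have hγ0 : η i γ ≠ 0 := by simpa using h0
    have hi : η i (γ * α ^ f) = γ * α ^ f := by
      rw [div_pow, inv_div, div_eq_div_iff (pow_ne_zero _ hα0) hγ0] at hf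
      rw [map_mul, map_pow, mul_comm, hf]
    have hne0 : γ * α ^ f ≠ 0 := mul_ne_zero h0 (pow_ne_zero _ hα0)
    have hk : ∀ k, k ≠ i → η k (γ * α ^ f) / (γ * α ^ f) = η k γ / γ := fun k hki => by
      rw [map_mul, map_pow, hfix k hki, mul_div_mul_right _ _ (pow_ne_zero _ hα0)]
    obtain ⟨δ, hδ0, hδ, hδfix, hδj⟩ := ih (γ * α ^ f) hne0 (by
      obtain ⟨c, hc⟩ := hγ
      refine ⟨c * a ^ (p ^ n * f), ?_⟩
      rw [map_mul, map_pow, hc, ha, mul_pow]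
      congr 1
      ring) (fun k hkj => by
        by_cases hki : k = i
        · rw [hki, hi, div_self hne0, one_pow]
        · rw [hk k hki, h1 k hkj]) (fun k hkj hks => by
        by_cases hki : k = i
        · rw [hki, hi]
        · rw [← div_eq_one_iff_eq hne0, hk k hki, div_eq_one_iff_eq h0]
          exact h2 k hkj (by simp [hki, hks]))
    exact ⟨δ, hδ0, hδ, hδfix, by rw [hδj, hk j (Ne.symm hij)]⟩

/-- Given `p`-th roots dual to the family `η`, there are also dual `p ^ (n + 1)`-th roots. -/
theorem exists_dual_pow_root [IsGalois F E] [IsSepClosed E] (hp : p.Prime) {z : F}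
    (hz : IsPrimitiveRoot z p) (hroots : ∀ n, ∃ ζ : E, IsPrimitiveRoot ζ (p ^ (n + 1)))
    (hfin : ∀ U : Subgroup Gal(E/F), IsOpen (U : Set Gal(E/F)) → maxProPKernel p Gal(E/F) ≤ U →
      {k | η k ∉ U}.Finite)
    (hdual : ∀ j, ∃ α : E, α ^ p ∈ Set.range (algebraMap F E) ∧
      (∀ k, k ≠ j → η k α = α) ∧ η j α ≠ α) (j : X) (n : ℕ) :
    ∃ β : E, β ≠ 0 ∧ β ^ p ^ (n + 1) ∈ Set.range (algebraMap F E) ∧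
      (∀ k, k ≠ j → η k β = β) ∧ IsPrimitiveRoot (η j β / β) (p ^ (n + 1)) := by
  have := Fact.mk hp
  have : NeZero p := ⟨hp.ne_zero⟩
  induction n with
  | zero =>
    obtain ⟨α, ⟨a, ha⟩, hfix, hne⟩ := hdual j
    have hα0 : α ≠ 0 := by
      rintro rfl
      exact hne (map_zero _)
    refine ⟨α, hα0, ⟨a, by simpa using ha⟩, hfix, ?_⟩
    rw [zero_add, pow_one, IsPrimitiveRoot.iff_orderOf]
    refine orderOf_eq_prime ?_ fun h => hne ((div_eq_one_iff_eq hα0).1 h)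
    rw [div_pow, ← map_pow, ← ha, AlgEquiv.commutes, ha, div_self (pow_ne_zero _ hα0)]
  | succ n ih =>
    obtain ⟨β, hβ0, hβ, hfix, hprim⟩ := ih
    have : NeZero (p : E) := (hz.map_of_injective (algebraMap F E).injective).neZero'
    obtain ⟨γ, rfl⟩ := IsSepClosed.exists_pow_nat_eq β p
    have hγ0 : γ ≠ 0 := by
      rintro rfl
      exact hβ0 (zero_pow hp.ne_zero)
    have hγ : γ ^ p ^ (n + 1 + 1) ∈ Set.range (algebraMap F E) := by
      rwa [pow_succ' p (n + 1), pow_mul]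
    obtain ⟨ζ, hζ⟩ := hroots (n + 1)
    -- `γ` lies in the maximal pro-`p` extension, so convergence to `1` leaves only finitely many `η
    -- k` to correct.
    have hs := hfin _ (isOpen_stabilizer γ) (maxProPKernel_le_stabilizer hp hz hζ hγ)
    obtain ⟨δ, hδ0, hδ, hδfix, hδj⟩ := exists_fixed_of_finite hp hdual j (n + 1) hs.toFinset γ hγ0 hγ
      (fun k hk => by rw [div_pow, ← map_pow, hfix k hk, div_self hβ0])
      (fun k _ hks => by
        by_contra h
        exact hks (hs.mem_toFinset.2 h))
    refine ⟨δ, hδ0, hδ, hδfix, ?_⟩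
    rw [map_pow, ← div_pow] at hprim
    rw [hδj, IsPrimitiveRoot.iff_orderOf]
    refine orderOf_eq_prime_pow (fun h => ?_) ?_
    · have h1 : ((η j γ / γ) ^ p) ^ p ^ n = 1 := by rwa [← pow_mul, ← pow_succ']
      exact hprim.pow_ne_one_of_pos_of_lt (pow_ne_zero _ hp.ne_zero)
        (Nat.pow_lt_pow_right hp.one_lt n.lt_succ_self) h1
    · rw [pow_succ', pow_mul, hprim.pow_eq_one]

end RootTower

/-! ### Dual roots from minimality, and the contradiction. -/

/-- Lifts of a minimal system of generators of the Galois group of the maximal pro-`p` extension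
have dual `p`-th roots of elements of the base field. -/
theorem IsMinimalGeneratingSystem.exists_dual_root {F E X : Type*} [Field F] [Field E] [Algebra F E]
    [IsGalois F E] {p : ℕ} (hp : p.Prime) {z : F} (hz : IsPrimitiveRoot z p) {η : X → Gal(E/F)}
    (hη : IsMinimalGeneratingSystem (G := MaxProPQuotient p Gal(E/F))
      (fun k => (η k : MaxProPQuotient p Gal(E/F)))) (j : X) :
    ∃ α : E, α ^ p ∈ Set.range (algebraMap F E) ∧ (∀ k, k ≠ j → η k α = α) ∧ η j α ≠ α := by
  set C := closedSubgroupClosure (G := MaxProPQuotient p Gal(E/F))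
    ((fun k => (η k : MaxProPQuotient p Gal(E/F))) '' {j}ᶜ) with hC
  have hmem : ∀ k, k ≠ j → (η k : MaxProPQuotient p Gal(E/F)) ∈ C := fun k hk =>
    Subgroup.le_topologicalClosure _ (Subgroup.subset_closure ⟨k, hk, rfl⟩)
  have hN : maxProPKernel p Gal(E/F) ≤
      C.comap (QuotientGroup.mk' (maxProPKernel p Gal(E/F))) := fun σ hσ => by
    rw [Subgroup.mem_comap, QuotientGroup.mk'_apply, (QuotientGroup.eq_one_iff σ).2 hσ]
    exact C.one_mem
  obtain ⟨M, hMn, hMo, hMi, hM⟩ := exists_open_normal_index_eq_prime hp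
    (H := C.comap (QuotientGroup.mk' (maxProPKernel p Gal(E/F))))
    ((Subgroup.isClosed_topologicalClosure _).preimage
      (QuotientGroup.continuous_mk (N := maxProPKernel p Gal(E/F)))) hN (fun h => by
      refine hη.minimal j (eq_top_iff.2 fun q _ => ?_)
      obtain ⟨σ, rfl⟩ := QuotientGroup.mk_surjective q
      exact (h ▸ Subgroup.mem_top σ :
        σ ∈ C.comap (QuotientGroup.mk' (maxProPKernel p Gal(E/F)))))
  obtain ⟨α, hα, hstab⟩ := exists_pow_mem_forall_mem_iff hp hz hMn hMo hMi
  refine ⟨α, hα, fun k hk => (hstab _).1 (hM (hmem k hk)), fun hj => ?_⟩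
  have hall : ∀ k, η k ∈ M := fun k => by
    by_cases hk : k = j
    · exact hk ▸ (hstab _).2 hj
    · exact hM (hmem k hk)
  -- If `η j` fixed `α` too, all the generators would lie in `M`, which has index `p`.
  have htop : M = ⊤ := eq_top_iff.2 fun σ _ => by
    refine mem_of_mk_mem_closedSubgroupClosure (hN.trans hM) hMo ?_
      (hη.generates ▸ Subgroup.mem_top (σ : MaxProPQuotient p Gal(E/F)))
    rintro τ ⟨k, hk⟩
    have : (η k)⁻¹ * τ ∈ maxProPKernel p Gal(E/F) := QuotientGroup.eq.1 hk
    simpa using M.mul_mem (hall k) (hM (hN this))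
  rw [htop, Subgroup.index_top] at hMi
  exact hp.one_lt.ne hMi

theorem theorem3p8 {p : ℕ} (hp : p.Prime) {F : Type*} [Field F]
    (hodd : p ≠ 2 → ∃ ζ : F, IsPrimitiveRoot ζ p)
    (htwo : p = 2 → ∃ ζ : F, IsPrimitiveRoot ζ 4)
    {S : Type*} [Group S] [TopologicalSpace S] [IsTopologicalGroup S]
    {I : Type*} (x : S) (y : I → S) (π : S →ₜ* GaloisProP p F)
    (hπ : IsMinimalPresentation p (adjoinFamily x y) π) :
    ¬ ∃ (l : ℕ) (u : ℤ) (s : S), 1 ≤ l ∧ Int.gcd (p : ℤ) u = 1 ∧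
      s ∈ closedSubgroupClosure (Set.range y) ∧
      x ^ ((p : ℤ) ^ l * u) * s ∈ (π : S →* GaloisProP p F).ker := by
  rintro ⟨l, u, s, hl, hu, hs, hker⟩
  have := Fact.mk hp
  -- `d` is `4` if `p = 2` and `p` otherwise; `1 ≤ l` is what gives `4 ∣ 2 ^ (l + 1)`.
  obtain ⟨d, w, hw, hpd, hdl, hd2⟩ : ∃ (d : ℕ) (w : F), IsPrimitiveRoot w d ∧ p ∣ d ∧
      d ∣ p ^ (l + 1) ∧ (p = 2 → 4 ∣ d) := by
    by_cases h2 : p = 2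
    · subst h2
      obtain ⟨w, hw⟩ := htwo rfl
      exact ⟨4, w, hw, by norm_num, pow_dvd_pow 2 (by omega : 2 ≤ l + 1), fun _ => dvd_rfl⟩
    · obtain ⟨w, hw⟩ := hodd h2
      exact ⟨p, w, hw, dvd_rfl, dvd_pow_self p l.succ_ne_zero, fun h => absurd h h2⟩
  obtain ⟨z, hz⟩ : ∃ z : F, IsPrimitiveRoot z p := by
    obtain ⟨e, rfl⟩ := hpd
    refine ⟨w ^ e, hw.pow (Nat.pos_of_ne_zero fun h => ?_) (mul_comm p e)⟩
    rw [h, zero_dvd_iff] at hdl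
    exact pow_ne_zero _ hp.ne_zero hdl
  have : NeZero p := ⟨hp.ne_zero⟩
  have : NeZero (p : F) := hz.neZero'
  have hroots : ∀ n, ∃ ζ : SeparableClosure F, IsPrimitiveRoot ζ (p ^ (n + 1)) := fun n =>
    HasEnoughRootsOfUnity.exists_primitiveRoot _ _
  choose η hη using fun k => QuotientGroup.mk_surjective (π (adjoinFamily x y k))
  have hmin : IsMinimalGeneratingSystem (G := GaloisProP p F) (fun k => (η k : GaloisProP p F)) := by
    have : (fun k => (η k : GaloisProP p F)) = π ∘ adjoinFamily x y := funext hη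
    rw [this]
    exact hπ.minimal
  have hfin : ∀ U : Subgroup Gal(SeparableClosure F/F), IsOpen (U : Set Gal(SeparableClosure F/F)) →
      maxProPKernel p Gal(SeparableClosure F/F) ≤ U → {k | η k ∉ U}.Finite := fun U hU hN => by
    have h := hmin.tendsto_one.eventually
      ((isOpen_map_mk (N := maxProPKernel p Gal(SeparableClosure F/F)) hU).mem_nhds
        (Subgroup.one_mem _))
    refine (Filter.eventually_cofinite.1 h).subset fun k hk hk' => hk ?_
    exact (mk_mem_map_mk_iff hN _).1 hk'
  obtain ⟨β, hβ0, hβ, hfix, hprim⟩ := exists_dual_pow_root hp hz hroots hfin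
    (fun j => hmin.exists_dual_root hp hz j) none l
  have hNβ := maxProPKernel_le_stabilizer hp hz hprim hβ
  obtain ⟨τ, hτ⟩ := QuotientGroup.mk_surjective (π s)
  have hτβ : τ ∈ MulAction.stabilizer Gal(SeparableClosure F/F) β := by
    have hle : closedSubgroupClosure (Set.range y) ≤
        (closedSubgroupClosure (π '' Set.range y)).comap (π : S →* GaloisProP p F) := by
      refine Subgroup.topologicalClosure_minimal _ ?_
        ((Subgroup.isClosed_topologicalClosure _).preimage π.continuous_toFun)
      rw [Subgroup.closure_le]
      exact fun t ht => Subgroup.le_topologicalClosure _ (Subgroup.subset_closure ⟨t, ht, rfl⟩)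
    refine mem_of_mk_mem_closedSubgroupClosure hNβ (isOpen_stabilizer β) ?_
      (hτ ▸ hle hs : (τ : GaloisProP p F) ∈ closedSubgroupClosure (π '' Set.range y))
    rintro ρ ⟨_, ⟨i, rfl⟩, hi⟩
    have h : (η (some i))⁻¹ * ρ ∈ maxProPKernel p Gal(SeparableClosure F/F) :=
      QuotientGroup.eq.1 ((hη (some i)).trans hi)
    have hi : η (some i) ∈ MulAction.stabilizer Gal(SeparableClosure F/F) β :=
      hfix (some i) (Option.some_ne_none i)
    simpa using Subgroup.mul_mem _ hi (hNβ h)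
  have hrel : η none ^ ((p : ℤ) ^ l * u) * τ ∈
      MulAction.stabilizer Gal(SeparableClosure F/F) β := by
    refine hNβ ((QuotientGroup.eq_one_iff _).1 ?_)
    rw [QuotientGroup.mk_mul, QuotientGroup.mk_zpow, hτ, hη none]
    have h : π (x ^ ((p : ℤ) ^ l * u) * s) = 1 := hker
    rwa [map_mul, map_zpow] at h
  have hpow : η none ^ (p ^ l * u.natAbs) ∈ MulAction.stabilizer Gal(SeparableClosure F/F) β := by
    have h := (Subgroup.mul_mem_cancel_right _ hτβ).1 hrel
    rw [← zpow_natCast]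
    push_cast
    rcases abs_choice u with hu' | hu' <;> rw [hu']
    · exact h
    · rw [mul_neg, zpow_neg]
      exact Subgroup.inv_mem _ h
  have hu' : ¬ p ∣ u.natAbs := fun h => by
    have : p ∣ Int.gcd (p : ℤ) u := Nat.dvd_gcd (by simp) h
    rw [hu] at this
    exact hp.one_lt.ne' (Nat.dvd_one.1 this)
  obtain ⟨k, hk, hdk⟩ := exists_apply_eq_pow hw hdl (pow_ne_zero _ hp.ne_zero) hprim (η none)
  have h1 : η none β = η none β / β * β := (div_mul_cancel₀ _ hβ0).symm
  have h2 : (η none ^ (p ^ l * u.natAbs)) β = β := hpow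
  rw [pow_apply_eq_mul hk h1, mul_eq_right₀ hβ0, hprim.pow_eq_one_iff_dvd] at h2
  refine not_pow_succ_dvd_geom_sum hp (k := k) ((Int.natCast_dvd_natCast.2 hpd).trans hdk)
    (fun h => (Int.natCast_dvd_natCast.2 (hd2 h)).trans hdk) l hu' ?_
  exact_mod_cast h2
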